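/- Consider the $M/M/2$ queue with strategic servers: customers arrive as a Poisson process of rate $\lambda>0$, wait in FIFO order when both servers are busy, and have independent service requirements, exponential with mean one at unit service rate; server $i\in\{1,2\}$ chooses a service rate $\mu_i>\lambda/2$. Under the $r$-routing policy ($r\in\mathbb{R}$), the next customer is sent to server $i$ in the set $\mathcal I$ of idle servers with probability $\mu_i^r/\sum_{j\in\mathcal I}\mu_j^r$; $r=0$ is the policy Random. Server $i$ has utility $U_i(\mu_1,\mu_2)=I_i(\mu_1,\mu_2)-c(\mu_i)$, where $I_i(\mu_1,\mu_2)$ is the steady-state probability that server $i$ is idle. The common effort cost $c$ is a (strictly) increasing, convex, three times differentiable function on $(0,\infty)$ with $c'''\ge 0$ and $c'(\lambda/2)<1/\lambda$. A rate $\mu^\star>\lambda/2$ is a symmetric equilibrium if $(\mu^\star,\mu^\star)$ is a Nash equilibrium, that is, $U_i(\mu^\star,\mu^\star)$ is the maximum of the utility of server $i$ over all rates $\mu_i>\lambda/2$ when the other server works at rate $\mu^\star$ ($i=1,2$). Then, for all $r\in\mathbb{R}$ and $\mu_1,\mu_2>\lambda/2$, the queue has a unique steady-state distribution (so the game is well defined),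 and for every $r\in\{-2,-1,0,1\}$ there is exactly one symmetric equilibrium under the $r$-routing policy. Moreover, the steady-state mean response time (waiting plus service) at the symmetric equilibrium is finite for $r=-2$ and for $r=0$, and it is strictly smaller for $r=-2$ than for $r=0$. -/

import Mathlib

open Set

noncomputable section

namespace MM2

/-- States of the two-server queue: nobody is present; exactly one customer is present, in service
at server `i` (the other server is idle); both servers are busy and `k` customers wait in line. -/
inductive State : Type
  | empty : State
  | single (i : Fin 2) : State
  | busy (k : ℕ) : State

/-- Under the `r`-routing policy, the probability that the next customer is sent to server `i`
when `idle` is the set of idle servers and `μ` is the vector of service rates. -/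
def routingProb (r : ℝ) (μ : Fin 2 → ℝ) (idle : Finset (Fin 2)) (i : Fin 2) : ℝ :=
  μ i ^ r / ∑ j ∈ idle, μ j ^ r

/-- Transition rates (between distinct states) of the Markov chain of the queue with Poisson
arrivals at rate `lam`, exponential services at rates `μ 0`, `μ 1`, first-in-first-out order and
`r`-routing. The server other than `i` is `Fin.rev i`. A customer who finds exactly one
idle server goes to that server. -/
def rate (lam r : ℝ) (μ : Fin 2 → ℝ) : State → State → ℝ
  | .empty, .single i => lam * routingProb r μ Finset.univ i
  | .single i, .empty => μ i
  | .single _, .busy 0 => lam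
  | .busy 0, .single i => μ (Fin.rev i)
  | .busy k, .busy l => if l = k + 1 then lam else if k = l + 1 then μ 0 + μ 1 else 0
  | _, _ => 0

/-- `π` is a steady-state distribution of the chain: a probability distribution on the states
that satisfies the global balance equations (flow into `s` equals flow out of `s`). All the flow
sums have only finitely many nonzero terms. -/
structure IsSteadyState (lam r : ℝ) (μ : Fin 2 → ℝ) (π : State → ℝ) : Prop where
  nonneg : ∀ s, 0 ≤ π s
  hasSum_one : HasSum π 1
  balance : ∀ s, ∑' t, π t * rate lam r μ t s = π s * ∑' t, rate lam r μ s t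

open Classical in
/-- The steady-state distribution (the zero function if there is none). -/
def steadyState (lam r : ℝ) (μ : Fin 2 → ℝ) : State → ℝ :=
  if h : ∃ π, IsSteadyState lam r μ π then h.choose else 0

/-- Server `i` is idle in the given state. -/
def IsIdle (i : Fin 2) : State → Prop
  | .empty => True
  | .single j => j ≠ i
  | .busy _ => False

/-- The steady-state probability that server `i` is idle. -/
def idleProb (lam r : ℝ) (μ : Fin 2 → ℝ) (i : Fin 2) : ℝ :=
  ∑' s, {s | IsIdle i s}.indicator (steadyState lam r μ) s

/-- The utility of server `i`: steady-state idleness minus the cost of effort. -/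
def utility (lam r : ℝ) (c : ℝ → ℝ) (μ : Fin 2 → ℝ) (i : Fin 2) : ℝ :=
  idleProb lam r μ i - c (μ i)

/-- Nash equilibria of the game in which every server chooses a rate in `(lam / 2, ∞)`. -/
def IsNashEquilibrium (lam r : ℝ) (c : ℝ → ℝ) (μ : Fin 2 → ℝ) : Prop :=
  (∀ i, lam / 2 < μ i) ∧
    ∀ i, ∀ x, lam / 2 < x → utility lam r c (Function.update μ i x) i ≤ utility lam r c μ i

/-- `m` is a symmetric equilibrium service rate. -/
def IsSymmetricEquilibrium (lam r : ℝ) (c : ℝ → ℝ) (m : ℝ) : Prop :=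
  IsNashEquilibrium lam r c fun _ => m

/-- Effort cost functions on the positive rates: increasing, convex, three times differentiable,
with nonnegative third derivative. -/
structure IsEffortCost (c : ℝ → ℝ) : Prop where
  strictMonoOn : StrictMonoOn c (Ioi 0)
  convexOn : ConvexOn ℝ (Ioi 0) c
  differentiableAt : ∀ k < 3, ∀ x > 0, DifferentiableAt ℝ (iteratedDeriv k c) x
  third_nonneg : ∀ x > 0, 0 ≤ iteratedDeriv 3 c x

/-- Mean response time (waiting plus service) of a customer who on arrival finds the given state.
A customer who finds both servers busy and `k` customers waiting needs `k + 1` departures, at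
total rate `μ 0 + μ 1`, before service starts; the last of them is at server `i`, who then serves
the customer, with probability `μ i / (μ 0 + μ 1)`. -/
def meanResponseFrom (r : ℝ) (μ : Fin 2 → ℝ) : State → ℝ
  | .empty => ∑ i, routingProb r μ Finset.univ i * (1 / μ i)
  | .single i => 1 / μ (Fin.rev i)
  | .busy k => (k + 1) / (μ 0 + μ 1) + ∑ i, μ i / (μ 0 + μ 1) * (1 / μ i)

/-- `T` is the (finite) mean response time of a customer who arrives to the queue in steady
state. -/
def HasMeanResponseTime (lam r : ℝ) (μ : Fin 2 → ℝ) (T : ℝ) : Prop :=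
  HasSum (fun s => steadyState lam r μ s * meanResponseFrom r μ s) T

end MM2

end

/-!
Under `r`-routing, the probability that a server of rate `x` is busy while its colleague has rate
`m` depends on `r` only through the odds `y = (m / x) ^ r`, in which it is decreasing. The claim
driving everything is that for `r ∈ [-2, 1]` it lies above its tangent at `x = m`. The tangent has
slope affine in `r`, and `(m / x) ^ r` is convex in `r`, so it is enough to replace the power by its
chord between consecutive integers. At integer `r` the gap is `(x - m) ^ 2` times a polynomial,
which, even after subtracting the error made by interpolating along the chord, has nonnegative
coefficients in `x - lam / 2` and `m - lam / 2`.

Since the cost is convex, symmetric equilibria are therefore exactly the solutions of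
`deriv c m = marginalIdle lam r m`. The right side strictly decreases in `m` and in `r` while
`deriv c` is monotone: solutions are unique and strictly decrease in `r`, and they exist because
`deriv c` has the Darboux property. At equal rates `m` the mean response time is
`4 * m / (4 * m ^ 2 - lam ^ 2)`, which decreases in `m`.
-/

namespace MM2

theorem rev_zero : Fin.rev (0 : Fin 2) = 1 := rfl

theorem rev_one : Fin.rev (1 : Fin 2) = 0 := rfl

theorem State.busy_injective : Function.Injective State.busy := fun _ _ => State.busy.inj

theorem hasSum_state {f : State → ℝ} {b : ℝ} (h : HasSum (fun k => f (.busy k)) b) :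
    HasSum f (f .empty + (f (.single 0) + f (.single 1)) + b) := by
  classical
  have hcompl : IsCompl (↑({.empty, .single 0, .single 1} : Finset State) : Set State)
      (range State.busy) := by
    rw [← eq_compl_iff_isCompl]
    ext s
    cases s with
    | empty => simp
    | single i => fin_cases i <;> simp
    | busy k => simp
  have hidle := Finset.hasSum {.empty, .single 0, .single 1} f
  have hbusy := (State.busy_injective.hasSum_range_iff (f := f)).2 h
  simpa [add_assoc] using hidle.add_isCompl hcompl hbusy

section Flow

variable (lam r : ℝ) (μ : Fin 2 → ℝ)

theorem tsum_rate_empty :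
    ∑' t, rate lam r μ .empty t
      = lam * (routingProb r μ Finset.univ 0 + routingProb r μ Finset.univ 1) := by
  have hbusy : HasSum (fun k => rate lam r μ .empty (.busy k)) 0 := by simp [rate, hasSum_zero]
  rw [(hasSum_state hbusy).tsum_eq]
  simp only [rate]
  ring

theorem tsum_rate_single (i : Fin 2) : ∑' t, rate lam r μ (.single i) t = μ i + lam := by
  have hbusy : HasSum (fun k => rate lam r μ (.single i) (.busy k)) lam := by
    convert hasSum_ite_eq (0 : ℕ) lam using 2 with k
    cases k <;> simp [rate]
  rw [(hasSum_state hbusy).tsum_eq]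
  simp [rate]

theorem tsum_rate_busy (k : ℕ) : ∑' t, rate lam r μ (.busy k) t = lam + (μ 0 + μ 1) := by
  cases k with
  | zero =>
    have hbusy : HasSum (fun l => rate lam r μ (.busy 0) (.busy l)) lam := by
      convert hasSum_ite_eq (1 : ℕ) lam using 2 with l
      simp [rate]
    rw [(hasSum_state hbusy).tsum_eq]
    simp [rate, Fin.rev]
    ring
  | succ k =>
    have hbusy : HasSum (fun l => rate lam r μ (.busy (k + 1)) (.busy l))
        (lam + (μ 0 + μ 1)) := by
      convert (hasSum_ite_eq (k + 2) lam).add (hasSum_ite_eq k (μ 0 + μ 1)) using 2 with l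
      simp only [rate]
      split_ifs <;> first | omega | simp
    rw [(hasSum_state hbusy).tsum_eq]
    simp [rate]

variable (π : State → ℝ)

theorem tsum_mul_rate_empty :
    ∑' t, π t * rate lam r μ t .empty = μ 0 * π (.single 0) + μ 1 * π (.single 1) := by
  have hbusy : HasSum (fun k => π (.busy k) * rate lam r μ (.busy k) .empty) 0 := by
    simp [rate, hasSum_zero]
  rw [(hasSum_state (f := fun t => π t * rate lam r μ t .empty) hbusy).tsum_eq]
  simp only [rate]
  ring

theorem tsum_mul_rate_single (i : Fin 2) :
    ∑' t, π t * rate lam r μ t (.single i)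
      = lam * routingProb r μ Finset.univ i * π .empty + μ (Fin.rev i) * π (.busy 0) := by
  have hbusy : HasSum (fun k => π (.busy k) * rate lam r μ (.busy k) (.single i))
      (μ (Fin.rev i) * π (.busy 0)) := by
    convert hasSum_ite_eq (0 : ℕ) (μ (Fin.rev i) * π (.busy 0)) using 2 with k
    cases k <;> simp [rate, mul_comm]
  rw [(hasSum_state (f := fun t => π t * rate lam r μ t (.single i)) hbusy).tsum_eq]
  simp only [rate]
  ring

theorem tsum_mul_rate_busy_zero :
    ∑' t, π t * rate lam r μ t (.busy 0)
      = lam * (π (.single 0) + π (.single 1)) + (μ 0 + μ 1) * π (.busy 1) := by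
  have hbusy : HasSum (fun k => π (.busy k) * rate lam r μ (.busy k) (.busy 0))
      ((μ 0 + μ 1) * π (.busy 1)) := by
    convert hasSum_ite_eq (1 : ℕ) ((μ 0 + μ 1) * π (.busy 1)) using 2 with k
    by_cases h : k = 1 <;> simp [rate, h, mul_comm]
  rw [(hasSum_state (f := fun t => π t * rate lam r μ t (.busy 0)) hbusy).tsum_eq]
  simp only [rate]
  ring

theorem tsum_mul_rate_busy_succ (k : ℕ) :
    ∑' t, π t * rate lam r μ t (.busy (k + 1))
      = lam * π (.busy k) + (μ 0 + μ 1) * π (.busy (k + 2)) := by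
  have hbusy : HasSum (fun l => π (.busy l) * rate lam r μ (.busy l) (.busy (k + 1)))
      (lam * π (.busy k) + (μ 0 + μ 1) * π (.busy (k + 2))) := by
    convert (hasSum_ite_eq k (lam * π (.busy k))).add
      (hasSum_ite_eq (k + 2) ((μ 0 + μ 1) * π (.busy (k + 2)))) using 2 with l
    simp only [rate]
    split_ifs <;> first | omega | (subst_vars; simp [mul_comm])
  rw [(hasSum_state (f := fun t => π t * rate lam r μ t (.busy (k + 1))) hbusy).tsum_eq]
  simp [rate]

end Flow

/-- The balance equations, with all flow sums evaluated, when a customer who finds the queue empty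
is sent to server `i` with probability `p i`. -/
structure IsBalanced (lam : ℝ) (p μ : Fin 2 → ℝ) (π : State → ℝ) : Prop where
  empty : μ 0 * π (.single 0) + μ 1 * π (.single 1) = π .empty * lam
  single : ∀ i, lam * p i * π .empty + μ (Fin.rev i) * π (.busy 0) = π (.single i) * (μ i + lam)
  busy_zero : lam * (π (.single 0) + π (.single 1)) + (μ 0 + μ 1) * π (.busy 1)
    = π (.busy 0) * (lam + (μ 0 + μ 1))
  busy_succ : ∀ k, lam * π (.busy k) + (μ 0 + μ 1) * π (.busy (k + 2))
    = π (.busy (k + 1)) * (lam + (μ 0 + μ 1))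

/-- A stationary measure of the chain, scaled so that no division by a service rate occurs; the
factors are read off from the cut equations. -/
noncomputable def weight (lam : ℝ) (p μ : Fin 2 → ℝ) : State → ℝ
  | .empty => μ 0 * μ 1 * (μ 0 + μ 1 + 2 * lam)
  | .single i => lam * μ (Fin.rev i) * (lam + p i * (μ 0 + μ 1))
  | .busy k => (lam / (μ 0 + μ 1)) ^ k * (lam ^ 2 * (lam + p 0 * μ 1 + p 1 * μ 0))

/-- The total mass of `weight` for a stable queue, see `hasSum_weight`. -/
noncomputable def totalWeight (lam : ℝ) (p μ : Fin 2 → ℝ) : ℝ :=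
  μ 0 * μ 1 * (μ 0 + μ 1 + 2 * lam) +
    lam * (μ 0 + μ 1) ^ 2 * (lam + p 0 * μ 1 + p 1 * μ 0) / (μ 0 + μ 1 - lam)

section Balance

variable {lam r : ℝ} {p μ : Fin 2 → ℝ} {π : State → ℝ}

theorem balance_iff_isBalanced
    (hp : routingProb r μ Finset.univ 0 + routingProb r μ Finset.univ 1 = 1) :
    (∀ s, ∑' t, π t * rate lam r μ t s = π s * ∑' t, rate lam r μ s t) ↔
      IsBalanced lam (routingProb r μ Finset.univ) μ π := by
  constructor
  · intro h
    constructor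
    · simpa only [tsum_mul_rate_empty, tsum_rate_empty, hp, mul_one] using h .empty
    · intro i
      simpa only [tsum_mul_rate_single, tsum_rate_single] using h (.single i)
    · simpa only [tsum_mul_rate_busy_zero, tsum_rate_busy] using h (.busy 0)
    · intro k
      simpa only [tsum_mul_rate_busy_succ, tsum_rate_busy] using h (.busy (k + 1))
  · rintro ⟨hempty, hsingle, hzero, hsucc⟩ s
    match s with
    | .empty => rw [tsum_mul_rate_empty, tsum_rate_empty, hp, mul_one, hempty]
    | .single i => rw [tsum_mul_rate_single, tsum_rate_single, hsingle]
    | .busy 0 => rw [tsum_mul_rate_busy_zero, tsum_rate_busy, hzero]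
    | .busy (k + 1) => rw [tsum_mul_rate_busy_succ, tsum_rate_busy, hsucc]

theorem IsBalanced.cut_zero (h : IsBalanced lam p μ π) (hp : p 0 + p 1 = 1) :
    (μ 0 + μ 1) * π (.busy 0) = lam * (π (.single 0) + π (.single 1)) := by
  have h0 := h.single 0
  have h1 := h.single 1
  rw [rev_zero] at h0
  rw [rev_one] at h1
  linear_combination h0 + h1 + h.empty - lam * π .empty * hp

theorem IsBalanced.cut_succ (h : IsBalanced lam p μ π) (hp : p 0 + p 1 = 1) (k : ℕ) :
    (μ 0 + μ 1) * π (.busy (k + 1)) = lam * π (.busy k) := by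
  induction k with
  | zero => linear_combination h.busy_zero + h.cut_zero hp
  | succ k ih => linear_combination h.busy_succ k + ih

theorem IsBalanced.mul_single (h : IsBalanced lam p μ π) (hp : p 0 + p 1 = 1) (i : Fin 2) :
    μ i * (μ 0 + μ 1 + 2 * lam) * π (.single i)
      = lam * (lam + p i * (μ 0 + μ 1)) * π .empty := by
  have h0 := h.single 0
  have h1 := h.single 1
  rw [rev_zero] at h0
  rw [rev_one] at h1
  match i with
  | 0 => linear_combination -(μ 0 + μ 1) * h0 + μ 1 * h.cut_zero hp + lam * h.empty
  | 1 => linear_combination -(μ 0 + μ 1) * h1 + μ 0 * h.cut_zero hp + lam * h.empty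

theorem IsBalanced.busy_eq (h : IsBalanced lam p μ π) (hp : p 0 + p 1 = 1) (hs : μ 0 + μ 1 ≠ 0)
    (k : ℕ) : π (.busy k) = (lam / (μ 0 + μ 1)) ^ k * π (.busy 0) := by
  induction k with
  | zero => simp
  | succ k ih =>
    apply mul_left_cancel₀ hs
    rw [h.cut_succ hp, ih, pow_succ]
    field_simp

theorem isBalanced_smul_weight (hs : μ 0 + μ 1 ≠ 0) (hp : p 0 + p 1 = 1) (a : ℝ) :
    IsBalanced lam p μ (a • weight lam p μ) := by
  have hp1 : p 1 = 1 - p 0 := by linarith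
  refine ⟨?_, Fin.forall_fin_two.2 ⟨?_, ?_⟩, ?_, fun k => ?_⟩ <;>
    simp only [weight, Pi.smul_apply, smul_eq_mul, rev_zero, rev_one, hp1, pow_succ, pow_zero] <;>
    field_simp <;> ring

theorem isBalanced_iff_exists_smul_weight (hlam : 0 < lam) (hμ : ∀ i, 0 < μ i)
    (hp : p 0 + p 1 = 1) :
    IsBalanced lam p μ π ↔ ∃ a : ℝ, π = a • weight lam p μ := by
  have h0 := hμ 0
  have h1 := hμ 1
  have hs : μ 0 + μ 1 ≠ 0 := by positivity
  refine ⟨fun h => ⟨π .empty / weight lam p μ .empty, ?_⟩, ?_⟩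
  · have hsingle (i : Fin 2) :
        π (.single i) = π .empty / weight lam p μ .empty * weight lam p μ (.single i) := by
      have hi := h.mul_single hp i
      revert i
      refine Fin.forall_fin_two.2 ⟨fun hi => ?_, fun hi => ?_⟩ <;>
        simp only [weight, rev_zero, rev_one] <;> field_simp <;> linear_combination hi
    funext s
    simp only [Pi.smul_apply, smul_eq_mul]
    match s with
    | .empty => field_simp [weight]
    | .single i => exact hsingle i
    | .busy k =>
      rw [h.busy_eq hp hs k, eq_div_of_mul_eq hs ((mul_comm _ _).trans (h.cut_zero hp)),
        hsingle 0, hsingle 1]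
      simp only [weight, rev_zero, rev_one, show p 1 = 1 - p 0 by linarith]
      field_simp
      ring
  · rintro ⟨a, rfl⟩
    exact isBalanced_smul_weight hs hp a

theorem weight_nonneg (hlam : 0 < lam) (hμ : ∀ i, 0 < μ i) (hp : ∀ i, 0 < p i) (s : State) :
    0 ≤ weight lam p μ s := by
  have h0 := hμ 0
  have h1 := hμ 1
  have hp0 := hp 0
  have hp1 := hp 1
  cases s with
  | empty =>
    simp only [weight]
    positivity
  | single i =>
    have := hμ (Fin.rev i)
    have := hp i
    simp only [weight]
    positivity
  | busy k =>
    simp only [weight]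
    positivity

theorem hasSum_weight_busy (hlam : 0 < lam) (hs : lam < μ 0 + μ 1) :
    HasSum (fun k => weight lam p μ (.busy k))
      (lam ^ 2 * (μ 0 + μ 1) * (lam + p 0 * μ 1 + p 1 * μ 0) / (μ 0 + μ 1 - lam)) := by
  have hs0 : 0 < μ 0 + μ 1 := hlam.trans hs
  have hvalue : (1 - lam / (μ 0 + μ 1))⁻¹ * (lam ^ 2 * (lam + p 0 * μ 1 + p 1 * μ 0))
      = lam ^ 2 * (μ 0 + μ 1) * (lam + p 0 * μ 1 + p 1 * μ 0) / (μ 0 + μ 1 - lam) := by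
    rw [one_sub_div hs0.ne']
    field_simp
  exact hvalue ▸ (hasSum_geometric_of_lt_one (by positivity) ((div_lt_one hs0).2 hs)).mul_right _

theorem hasSum_weight (hlam : 0 < lam) (hs : lam < μ 0 + μ 1) (hp : p 0 + p 1 = 1) :
    HasSum (weight lam p μ) (totalWeight lam p μ) := by
  have hsub : μ 0 + μ 1 - lam ≠ 0 := (sub_pos.2 hs).ne'
  convert hasSum_state (hasSum_weight_busy hlam hs) using 1
  simp only [weight, totalWeight, rev_zero, rev_one, show p 1 = 1 - p 0 by linarith]
  field_simp
  ring

theorem totalWeight_pos (hlam : 0 < lam) (hμ : ∀ i, 0 < μ i) (hs : lam < μ 0 + μ 1)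
    (hp : ∀ i, 0 < p i) : 0 < totalWeight lam p μ := by
  have h0 := hμ 0
  have h1 := hμ 1
  have hp0 := hp 0
  have hp1 := hp 1
  rw [totalWeight]
  positivity

end Balance

section SteadyState

variable {lam r : ℝ} {μ : Fin 2 → ℝ}

theorem routingProb_univ_pos (hμ : ∀ i, 0 < μ i) (i : Fin 2) :
    0 < routingProb r μ Finset.univ i :=
  div_pos (Real.rpow_pos_of_pos (hμ i) r)
    (Finset.sum_pos (fun j _ => Real.rpow_pos_of_pos (hμ j) r) Finset.univ_nonempty)

theorem sum_routingProb_univ (hμ : ∀ i, 0 < μ i) :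
    routingProb r μ Finset.univ 0 + routingProb r μ Finset.univ 1 = 1 := by
  have h0 := Real.rpow_pos_of_pos (hμ 0) r
  have h1 := Real.rpow_pos_of_pos (hμ 1) r
  simp only [routingProb, Fin.sum_univ_two]
  field_simp

theorem isSteadyState_iff (hlam : 0 < lam) (hμ : ∀ i, 0 < μ i) (hs : lam < μ 0 + μ 1)
    {π : State → ℝ} :
    IsSteadyState lam r μ π ↔ π = (totalWeight lam (routingProb r μ Finset.univ) μ)⁻¹ •
      weight lam (routingProb r μ Finset.univ) μ := by
  have hp := sum_routingProb_univ (r := r) hμ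
  have hp0 := routingProb_univ_pos (r := r) hμ
  have hZ := totalWeight_pos hlam hμ hs hp0
  have hsum := hasSum_weight hlam hs hp
  constructor
  · rintro ⟨-, hone, hbal⟩
    obtain ⟨a, rfl⟩ := (isBalanced_iff_exists_smul_weight hlam hμ hp).1
      ((balance_iff_isBalanced hp).1 hbal)
    rw [eq_inv_of_mul_eq_one_left ((hsum.const_smul a).unique hone)]
  · rintro rfl
    refine ⟨fun s => mul_nonneg (inv_nonneg.2 hZ.le) (weight_nonneg hlam hμ hp0 s), ?_,
      (balance_iff_isBalanced hp).2 (isBalanced_smul_weight (hlam.trans hs).ne' hp _)⟩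
    have hone := hsum.const_smul (totalWeight lam (routingProb r μ Finset.univ) μ)⁻¹
    rwa [smul_eq_mul, inv_mul_cancel₀ hZ.ne'] at hone

theorem existsUnique_isSteadyState (hlam : 0 < lam) (hμ : ∀ i, 0 < μ i) (hs : lam < μ 0 + μ 1) :
    ∃! π, IsSteadyState lam r μ π := by
  simp only [isSteadyState_iff hlam hμ hs, existsUnique_eq]

theorem steadyState_eq (hlam : 0 < lam) (hμ : ∀ i, 0 < μ i) (hs : lam < μ 0 + μ 1) :
    steadyState lam r μ = (totalWeight lam (routingProb r μ Finset.univ) μ)⁻¹ •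
      weight lam (routingProb r μ Finset.univ) μ := by
  have h := (existsUnique_isSteadyState (r := r) hlam hμ hs).exists
  rw [steadyState, dif_pos h]
  exact (isSteadyState_iff hlam hμ hs).1 h.choose_spec

theorem idleProb_eq (hlam : 0 < lam) (hμ : ∀ i, 0 < μ i) (hs : lam < μ 0 + μ 1) (i : Fin 2) :
    idleProb lam r μ i =
      (weight lam (routingProb r μ Finset.univ) μ .empty +
        weight lam (routingProb r μ Finset.univ) μ (.single (Fin.rev i))) /
      totalWeight lam (routingProb r μ Finset.univ) μ := by
  have hbusy : HasSum (fun k => {s | IsIdle i s}.indicator (steadyState lam r μ) (.busy k)) 0 := by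
    simp [IsIdle, hasSum_zero]
  rw [idleProb, (hasSum_state hbusy).tsum_eq, steadyState_eq hlam hμ hs]
  fin_cases i <;> simp [IsIdle, Fin.rev, div_eq_inv_mul, mul_add]

end SteadyState

/-- Numerator of the probability that a server of rate `x` is busy when the other one has rate `m`
and `y` is the odds that a customer who finds the queue empty is sent to the other one, see
`busyProb`. -/
def busyNum (lam x m y : ℝ) : ℝ :=
  m * (x + m) ^ 2 + lam * m * (x + m) + lam ^ 2 * x + y * (lam * (x + m) ^ 2 + lam ^ 2 * x)

/-- The normalizing constant of the stationary measure when every customer who finds the queue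
empty is sent to the server of rate `m`, and the other server has rate `x`. -/
def soloMass (lam x m : ℝ) : ℝ :=
  x * m * (x + m) * (x + m + lam) + lam ^ 2 * (x ^ 2 + m ^ 2) + lam * (x + m) ^ 2 * x

/-- Denominator of `busyProb`: the routing odds `y` mix the normalizing constants of the two
policies that always prefer the same server. -/
def busyDen (lam x m y : ℝ) : ℝ :=
  soloMass lam m x + y * soloMass lam x m

/-- The probability that a server of rate `x` is busy when the other one has rate `m` and the odds
that a customer who finds the queue empty is sent to the other one are `y : 1`. -/
noncomputable def busyProb (lam x m y : ℝ) : ℝ :=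
  lam * busyNum lam x m y / busyDen lam x m y

section BusyProb

variable {lam x m y z r : ℝ}

theorem soloMass_pos (hlam : 0 < lam) (hx : 0 < x) (hm : 0 < m) : 0 < soloMass lam x m := by
  rw [soloMass]
  positivity

theorem busyDen_pos (hlam : 0 < lam) (hx : 0 < x) (hm : 0 < m) (hy : 0 ≤ y) :
    0 < busyDen lam x m y :=
  add_pos_of_pos_of_nonneg (soloMass_pos hlam hm hx)
    (mul_nonneg hy (soloMass_pos hlam hx hm).le)

theorem busyProb_one (hlam : 0 < lam) (hm : 0 < m) : busyProb lam m m 1 = lam / (2 * m) := by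
  have hden := busyDen_pos hlam hm hm zero_le_one
  rw [busyProb, div_eq_div_iff hden.ne' (by positivity)]
  simp only [busyNum, busyDen, soloMass]
  ring

theorem busyProb_le_busyProb (hlam : 0 < lam) (hx : 0 < x) (hm : 0 < m) (hs : lam < x + m)
    (hy : 0 ≤ y) (hyz : y ≤ z) : busyProb lam x m z ≤ busyProb lam x m y := by
  rw [busyProb, busyProb, div_le_div_iff₀ (busyDen_pos hlam hx hm (hy.trans hyz))
    (busyDen_pos hlam hx hm hy), ← sub_nonneg]
  have hcross : lam * busyNum lam x m y * busyDen lam x m z -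
      lam * busyNum lam x m z * busyDen lam x m y =
      (z - y) * (lam * x * m ^ 2 * (x + m) * (x + m - lam) * (x + m + lam) *
        (x + m + 2 * lam)) := by
    simp only [busyNum, busyDen, soloMass]
    ring
  rw [hcross]
  exact mul_nonneg (sub_nonneg.2 hyz) (by positivity)

theorem routingProb_univ_eq {μ : Fin 2 → ℝ} (hμ : ∀ i, 0 < μ i) (i : Fin 2) :
    routingProb r μ Finset.univ i = 1 / (1 + (μ (Fin.rev i) / μ i) ^ r) := by
  have hi := Real.rpow_pos_of_pos (hμ i) r
  rw [routingProb, Real.div_rpow (hμ _).le (hμ _).le, one_add_div hi.ne', one_div_div]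
  fin_cases i <;> simp [Fin.rev, add_comm]

theorem idle_mass_div_eq_one_sub_busyProb (hlam : 0 < lam) (hx : 0 < x) (hm : 0 < m)
    (hs : lam < x + m) (hy : 0 < y) :
    (x * m * (x + m + 2 * lam) + lam * x * (lam + y / (1 + y) * (x + m))) /
      (x * m * (x + m + 2 * lam) +
        lam * (x + m) ^ 2 * (lam + 1 / (1 + y) * m + y / (1 + y) * x) / (x + m - lam)) =
      1 - busyProb lam x m y := by
  have hden := busyDen_pos hlam hx hm hy.le
  have hsub := sub_pos.2 hs
  have hmass : x * m * (x + m + 2 * lam) +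
      lam * (x + m) ^ 2 * (lam + 1 / (1 + y) * m + y / (1 + y) * x) / (x + m - lam) =
      busyDen lam x m y / ((1 + y) * (x + m - lam)) := by
    simp only [busyDen, soloMass]
    field_simp
    ring
  rw [hmass, busyProb, one_sub_div hden.ne']
  field_simp
  simp only [busyNum, busyDen, soloMass]
  ring

theorem idleProb_eq_one_sub_busyProb {μ : Fin 2 → ℝ} (hlam : 0 < lam) (hμ : ∀ i, 0 < μ i)
    (hs : lam < μ 0 + μ 1) (i : Fin 2) :
    idleProb lam r μ i =
      1 - busyProb lam (μ i) (μ (Fin.rev i)) ((μ (Fin.rev i) / μ i) ^ r) := by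
  have hs' : lam < μ i + μ (Fin.rev i) := by
    match i with
    | 0 => exact hs
    | 1 => rwa [rev_one, add_comm]
  have hi := hμ i
  have hrev := hμ (Fin.rev i)
  have hy := Real.rpow_pos_of_pos (div_pos hrev hi) r
  have hp := routingProb_univ_eq (r := r) hμ i
  have hq : routingProb r μ Finset.univ (Fin.rev i) =
      (μ (Fin.rev i) / μ i) ^ r / (1 + (μ (Fin.rev i) / μ i) ^ r) := by
    rw [routingProb_univ_eq hμ, Fin.rev_rev, ← inv_div (μ (Fin.rev i)),
      Real.inv_rpow (by positivity)]
    field_simp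
    ring
  rw [← idle_mass_div_eq_one_sub_busyProb hlam hi hrev hs' hy, ← hp, ← hq,
    idleProb_eq hlam hμ hs]
  simp only [weight, totalWeight, Fin.rev_rev]
  match i with
  | 0 => simp only [rev_zero]
  | 1 =>
    simp only [rev_one]
    ring_nf

end BusyProb

/-- The marginal idleness at the diagonal: the derivative at `x = m` of the idle probability of a
server of rate `x` whose colleague has rate `m`, under `r`-routing. -/
noncomputable def marginalIdle (lam r m : ℝ) : ℝ :=
  lam * ((4 - 2 * r) * m + (4 + r) * lam) / (4 * m * (m + lam) * (2 * m + lam))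

section MarginalIdle

variable {lam r r' m : ℝ}

theorem differentiableAt_busyProb (hlam : 0 < lam) (hm : 0 < m) :
    DifferentiableAt ℝ (fun x => busyProb lam x m ((m / x) ^ r)) m := by
  have hodds : DifferentiableAt ℝ (fun x => (m / x) ^ r) m :=
    ((differentiableAt_const m).div differentiableAt_id hm.ne').rpow_const
      (Or.inl (div_ne_zero hm.ne' hm.ne'))
  have hden := busyDen_pos hlam hm hm (Real.rpow_nonneg (div_pos hm hm).le r)
  simp only [busyProb]
  refine DifferentiableAt.div ?_ ?_ hden.ne'
  · simp only [busyNum]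
    fun_prop
  · simp only [busyDen, soloMass]
    fun_prop

theorem marginalIdle_half (hlam : 0 < lam) : marginalIdle lam r (lam / 2) = 1 / lam := by
  rw [marginalIdle]
  field_simp
  ring

theorem strictAntiOn_marginalIdle (hlam : 0 < lam) (hr : -4 < r) (hr' : r < 2) :
    StrictAntiOn (marginalIdle lam r) (Ioi 0) := by
  have heq (x : ℝ) (hx : 0 < x) : marginalIdle lam r x =
      lam / 4 * ((4 - 2 * r) / ((x + lam) * (2 * x + lam)) +
        (4 + r) * lam / (x * ((x + lam) * (2 * x + lam)))) := by
    rw [marginalIdle]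
    field_simp
  intro a ha b hb hab
  have ha0 : 0 < a := ha
  have hb0 : 0 < b := hb
  have h2 : 0 < 4 - 2 * r := by linarith
  have h4 : 0 < 4 + r := by linarith
  rw [heq a ha0, heq b hb0]
  gcongr

theorem marginalIdle_lt (hlam : 0 < lam) (hr : -4 < r) (hr' : r < 2) (hm : 0 < m) :
    marginalIdle lam r m < 3 / m := by
  rw [marginalIdle, div_lt_div_iff₀ (by positivity) hm]
  have h1 : (4 - 2 * r) * m < 12 * m := by gcongr; linarith
  have h2 : (4 + r) * lam < 12 * lam := by gcongr; linarith
  calc lam * ((4 - 2 * r) * m + (4 + r) * lam) * m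
      < lam * (12 * m + 12 * lam) * m := by gcongr
    _ ≤ lam * (12 * m + 12 * lam) * m + 24 * m ^ 2 * (m + lam) :=
        le_add_of_nonneg_right (by positivity)
    _ = 3 * (4 * m * (m + lam) * (2 * m + lam)) := by ring

theorem marginalIdle_lt_marginalIdle (hlam : 0 < lam) (hm : lam / 2 < m) (hr : r < r') :
    marginalIdle lam r' m < marginalIdle lam r m := by
  have hm0 : 0 < m := (half_pos hlam).trans hm
  have hnum : (4 - 2 * r') * m + (4 + r') * lam < (4 - 2 * r) * m + (4 + r) * lam := by
    linarith [mul_pos (sub_pos.2 hr) (sub_pos.2 hm)]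
  rw [marginalIdle, marginalIdle]
  gcongr

theorem continuousOn_marginalIdle (hlam : 0 < lam) :
    ContinuousOn (marginalIdle lam r) (Ioi 0) := by
  unfold marginalIdle
  refine ContinuousOn.div (by fun_prop) (by fun_prop) fun x hx => ?_
  have hx0 : 0 < x := hx
  positivity

end MarginalIdle

/-- The numerator, over a positive common denominator, of the difference between the busy
probability and its tangent at the diagonal. The odds `y` are kept free, which makes the gap affine
both in `y` and in `r`. -/
def tangentGap (lam r x m y : ℝ) : ℝ :=
  4 * m * (m + lam) * (2 * m + lam) * busyNum lam x m y -
    (2 * (m + lam) * (2 * m + lam) - ((4 - 2 * r) * m + (4 + r) * lam) * (x - m)) *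
      busyDen lam x m y

section TangentGap

variable {lam r x m y z θ : ℝ}

theorem tangent_le_busyProb_iff (hlam : 0 < lam) (hx : 0 < x) (hm : 0 < m) (hy : 0 ≤ y) :
    lam / (2 * m) - marginalIdle lam r m * (x - m) ≤ busyProb lam x m y ↔
      0 ≤ tangentGap lam r x m y := by
  have hden := busyDen_pos hlam hx hm hy
  have hgap : busyProb lam x m y - (lam / (2 * m) - marginalIdle lam r m * (x - m)) =
      lam / (4 * m * (m + lam) * (2 * m + lam) * busyDen lam x m y) *
        tangentGap lam r x m y := by
    rw [busyProb, marginalIdle, tangentGap]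
    field_simp
    ring
  rw [← sub_nonneg, hgap]
  exact mul_nonneg_iff_of_pos_left (by positivity)

theorem tangentGap_interpolate :
    tangentGap lam (r + θ) x m ((1 - θ) * y + θ * z) =
      (1 - θ) * tangentGap lam r x m y + θ * tangentGap lam (r + 1) x m z -
        θ * (1 - θ) * ((2 * m - lam) * (x - m) * (y - z) * soloMass lam x m) := by
  simp only [tangentGap, busyNum, busyDen]
  ring

theorem tangentGap_interpolate_nonneg (hθ : θ ∈ Icc (0 : ℝ) 1)
    (hmixed : 0 ≤ (2 * m - lam) * (x - m) * (y - z) * soloMass lam x m)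
    (hleft : (2 * m - lam) * (x - m) * (y - z) * soloMass lam x m ≤ tangentGap lam r x m y)
    (hright : 0 ≤ tangentGap lam (r + 1) x m z) :
    0 ≤ tangentGap lam (r + θ) x m ((1 - θ) * y + θ * z) := by
  have hθ0 := hθ.1
  have hθ1 := sub_nonneg.2 hθ.2
  rw [tangentGap_interpolate]
  linear_combination (1 - θ) * hleft + θ * hright + (1 - θ) ^ 2 * hmixed

/-- The quotient of `tangentGap` by `(x - m) ^ 2` for `r = 0`. -/
def remainderZero (lam x m : ℝ) : ℝ :=
  8 * m ^ 2 * (x + m) ^ 2 + 4 * lam * m * (x + m) * (5 * m + 3 * x) +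
    2 * lam ^ 2 * (m ^ 2 + 11 * m * x + 2 * x ^ 2) - 2 * lam ^ 3 * (7 * m - 3 * x) - 4 * lam ^ 4

/-- The quotient of `tangentGap` by `(x - m) ^ 2 / x` for `r = 1`. -/
def remainderOne (lam x m : ℝ) : ℝ :=
  (x + m) * (2 * m ^ 2 * x * (x + m) + lam * m * (8 * m ^ 2 + 15 * m * x + 5 * x ^ 2) +
    3 * lam ^ 2 * m * (2 * m + 5 * x) + lam ^ 3 * (5 * x - 7 * m) - 2 * lam ^ 4)

/-- The quotient of `tangentGap` by `(x - m) ^ 2 / m` for `r = -1`. -/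
def remainderNegOne (lam x m : ℝ) : ℝ :=
  (x + m) * (x + m + lam) * (2 * m ^ 2 * (4 * m + 3 * x) + lam * m * (2 * m + 9 * x) +
    lam ^ 2 * (3 * x - 5 * m) - 2 * lam ^ 3)

/-- The quotient of `tangentGap` by `(x - m) ^ 2 / m ^ 2` for `r = -2`. -/
def remainderNegTwo (lam x m : ℝ) : ℝ :=
  4 * m ^ 2 * (x + m) ^ 2 * (2 * m ^ 2 + m * x + 2 * x ^ 2) +
    2 * lam * m * (x + m) * (4 * m ^ 3 + 2 * m ^ 2 * x + 9 * m * x ^ 2 + 5 * x ^ 3) +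
    lam ^ 2 * (-4 * m ^ 4 + 4 * m ^ 3 * x - 10 * m ^ 2 * x ^ 2 + 8 * m * x ^ 3 + 2 * x ^ 4) -
    lam ^ 3 * (6 * m ^ 3 + 10 * m * x ^ 2) - 2 * lam ^ 4 * (m ^ 2 + x ^ 2)

theorem mul_soloMass_le_remainderZero (hlam : 0 < lam) (hx : lam / 2 < x) (hm : lam / 2 < m) :
    (2 * m - lam) * soloMass lam x m ≤ x * remainderZero lam x m := by
  obtain ⟨a, ha, rfl⟩ := exists_pos_add_of_lt' hx
  obtain ⟨b, hb, rfl⟩ := exists_pos_add_of_lt' hm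
  rw [← sub_nonneg]
  simp only [remainderZero, soloMass]
  ring_nf
  positivity

theorem mul_soloMass_le_remainderOne (hlam : 0 < lam) (hx : lam / 2 < x) (hm : lam / 2 < m) :
    (2 * m - lam) * soloMass lam x m ≤ remainderOne lam x m := by
  obtain ⟨a, ha, rfl⟩ := exists_pos_add_of_lt' hx
  obtain ⟨b, hb, rfl⟩ := exists_pos_add_of_lt' hm
  rw [← sub_nonneg]
  simp only [remainderOne, soloMass]
  ring_nf
  positivity

theorem mul_soloMass_le_remainderNegOne (hlam : 0 < lam) (hx : lam / 2 < x) (hm : lam / 2 < m) :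
    (2 * m - lam) * soloMass lam x m ≤ remainderNegOne lam x m := by
  obtain ⟨a, ha, rfl⟩ := exists_pos_add_of_lt' hx
  obtain ⟨b, hb, rfl⟩ := exists_pos_add_of_lt' hm
  rw [← sub_nonneg]
  simp only [remainderNegOne, soloMass]
  ring_nf
  positivity

theorem mul_soloMass_le_remainderNegTwo (hlam : 0 < lam) (hx : lam / 2 < x) (hm : lam / 2 < m) :
    x * ((2 * m - lam) * soloMass lam x m) ≤ remainderNegTwo lam x m := by
  obtain ⟨a, ha, rfl⟩ := exists_pos_add_of_lt' hx
  obtain ⟨b, hb, rfl⟩ := exists_pos_add_of_lt' hm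
  rw [← sub_nonneg]
  simp only [remainderNegTwo, soloMass]
  ring_nf
  positivity

/-- The left side is the mixed term of `tangentGap_interpolate` for the odds `(m / x) ^ k` and
`(m / x) ^ (k + 1)`. -/
theorem mixed_le_tangentGap (hlam : 0 < lam) (hx : lam / 2 < x) (hm : lam / 2 < m) {k : ℤ}
    (hk : k ∈ Icc (-2) 0) :
    (2 * m - lam) * (x - m) * ((m / x) ^ k - (m / x) ^ (k + 1)) * soloMass lam x m ≤
      tangentGap lam k x m ((m / x) ^ k) := by
  have hx0 : 0 < x := (half_pos hlam).trans hx
  have hm0 : 0 < m := (half_pos hlam).trans hm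
  obtain ⟨hk2, hk0⟩ := hk
  rw [← sub_nonneg]
  interval_cases k
  · refine (mul_nonneg (show 0 ≤ (x - m) ^ 2 / m ^ 2 by positivity)
      (sub_nonneg.2 (mul_soloMass_le_remainderNegTwo hlam hx hm))).trans_eq ?_
    simp only [tangentGap, busyNum, busyDen, soloMass, remainderNegTwo]
    simp only [Int.reduceNeg, Int.reduceAdd, Int.cast_neg, Int.cast_ofNat, zpow_neg, zpow_ofNat,
      pow_one]
    field_simp
    ring
  · refine (mul_nonneg (show 0 ≤ (x - m) ^ 2 / m by positivity)
      (sub_nonneg.2 (mul_soloMass_le_remainderNegOne hlam hx hm))).trans_eq ?_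
    simp only [tangentGap, busyNum, busyDen, soloMass, remainderNegOne]
    simp only [Int.reduceNeg, Int.cast_neg, Int.cast_one, zpow_neg, zpow_ofNat, pow_one,
      neg_add_cancel, pow_zero]
    field_simp
    ring
  · refine (mul_nonneg (show 0 ≤ (x - m) ^ 2 / x by positivity)
      (sub_nonneg.2 (mul_soloMass_le_remainderZero hlam hx hm))).trans_eq ?_
    simp only [tangentGap, busyNum, busyDen, soloMass, remainderZero]
    simp only [Int.cast_zero, zpow_ofNat, zero_add, pow_one, pow_zero]
    field_simp
    ring

theorem mixed_nonneg (hlam : 0 < lam) (hx : 0 < x) (hm : lam / 2 < m) (k : ℤ) :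
    0 ≤ (2 * m - lam) * (x - m) * ((m / x) ^ k - (m / x) ^ (k + 1)) * soloMass lam x m := by
  have hm0 : 0 < m := (half_pos hlam).trans hm
  have hsub : 0 < 2 * m - lam := by linarith
  have hsolo := soloMass_pos hlam hx hm0
  have hodds : (m / x) ^ k - (m / x) ^ (k + 1) = (x - m) * ((m / x) ^ k / x) := by
    rw [zpow_add_one₀ (div_pos hm0 hx).ne']
    field_simp
  rw [hodds, mul_assoc (2 * m - lam), ← mul_assoc (x - m)]
  have hsq := mul_self_nonneg (x - m)
  positivity

theorem tangentGap_one_nonneg (hlam : 0 < lam) (hx : lam / 2 < x) (hm : lam / 2 < m) :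
    0 ≤ tangentGap lam 1 x m (m / x) := by
  have hx0 : 0 < x := (half_pos hlam).trans hx
  have hm0 : 0 < m := (half_pos hlam).trans hm
  have hsolo := soloMass_pos hlam hx0 hm0
  have hrem : 0 ≤ remainderOne lam x m :=
    (mul_nonneg (by linarith) hsolo.le).trans (mul_soloMass_le_remainderOne hlam hx hm)
  refine (mul_nonneg (show 0 ≤ (x - m) ^ 2 / x by positivity) hrem).trans_eq ?_
  simp only [tangentGap, busyNum, busyDen, soloMass, remainderOne]
  field_simp
  ring

theorem tangentGap_zpow_nonneg (hlam : 0 < lam) (hx : lam / 2 < x) (hm : lam / 2 < m) {k : ℤ}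
    (hk : k ∈ Icc (-2) 1) : 0 ≤ tangentGap lam k x m ((m / x) ^ k) := by
  rcases hk.2.eq_or_lt with rfl | hk1
  · simpa using tangentGap_one_nonneg hlam hx hm
  · exact (mixed_nonneg hlam ((half_pos hlam).trans hx) hm k).trans
      (mixed_le_tangentGap hlam hx hm ⟨hk.1, Int.lt_add_one_iff.1 hk1⟩)

theorem rpow_add_le_zpow_chord {b : ℝ} (hb : 0 < b) (k : ℤ) (hθ : θ ∈ Icc (0 : ℝ) 1) :
    b ^ ((k : ℝ) + θ) ≤ (1 - θ) * b ^ k + θ * b ^ (k + 1) := by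
  have hconv := (convexOn_rpow_left hb).2 (mem_univ (k : ℝ)) (mem_univ ((k + 1 : ℤ) : ℝ))
    (sub_nonneg.2 hθ.2) hθ.1 (sub_add_cancel 1 θ)
  have hexp : (1 - θ) • (k : ℝ) + θ • ((k + 1 : ℤ) : ℝ) = k + θ := by
    simp only [smul_eq_mul, Int.cast_add, Int.cast_one]
    ring
  rw [hexp] at hconv
  simpa only [smul_eq_mul, Real.rpow_intCast] using hconv

theorem tangent_le_busyProb_rpow (hlam : 0 < lam) (hx : lam / 2 < x) (hm : lam / 2 < m)
    (hr : r ∈ Icc (-2) 1) :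
    lam / (2 * m) - marginalIdle lam r m * (x - m) ≤ busyProb lam x m ((m / x) ^ r) := by
  have hx0 : 0 < x := (half_pos hlam).trans hx
  have hm0 : 0 < m := (half_pos hlam).trans hm
  have hmx : 0 < m / x := div_pos hm0 hx0
  obtain ⟨k, hk, θ, hθ, rfl⟩ : ∃ k ∈ Icc (-2 : ℤ) 0, ∃ θ ∈ Icc (0 : ℝ) 1, r = k + θ := by
    rcases hr.2.eq_or_lt with rfl | hr1
    · exact ⟨0, by simp, 1, by simp, by simp⟩
    · refine ⟨⌊r⌋, ⟨Int.le_floor.2 (by exact_mod_cast hr.1), ?_⟩, Int.fract r,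
        ⟨Int.fract_nonneg r, (Int.fract_lt_one r).le⟩, (Int.floor_add_fract r).symm⟩
      exact Int.lt_add_one_iff.1 (Int.floor_lt.2 (by simpa using hr1))
  have hchord := rpow_add_le_zpow_chord hmx k hθ
  have hodds := (Real.rpow_pos_of_pos hmx (k + θ)).le
  refine le_trans ?_ (busyProb_le_busyProb hlam hx0 hm0 (by linarith) hodds hchord)
  rw [tangent_le_busyProb_iff hlam hx0 hm0 (hodds.trans hchord)]
  refine tangentGap_interpolate_nonneg hθ (mixed_nonneg hlam hx0 hm k)
    (mixed_le_tangentGap hlam hx hm hk) ?_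
  exact_mod_cast tangentGap_zpow_nonneg hlam hx hm (k := k + 1)
    ⟨by linarith [hk.1], by linarith [hk.2]⟩

end TangentGap

section ConvexCost

variable {s : Set ℝ} {c f g : ℝ → ℝ} {a b m x f' : ℝ}

theorem deriv_mul_sub_le_of_convexOn (hconv : ConvexOn ℝ s c) (hm : m ∈ s) (hx : x ∈ s)
    (hc : DifferentiableAt ℝ c m) : deriv c m * (x - m) ≤ c x - c m := by
  rcases lt_trichotomy x m with hlt | rfl | hlt
  · have hslope := hconv.slope_le_deriv hx hm hlt hc
    rw [slope_def_field, div_le_iff₀ (sub_pos.2 hlt)] at hslope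
    linarith
  · simp
  · have hslope := hconv.deriv_le_slope hm hx hlt hc
    rwa [slope_def_field, le_div_iff₀ (sub_pos.2 hlt)] at hslope

theorem deriv_pos_of_convexOn_of_strictMonoOn (hs : IsOpen s) (hconv : ConvexOn ℝ s c)
    (hmono : StrictMonoOn c s) (hm : m ∈ s) (hc : DifferentiableAt ℝ c m) : 0 < deriv c m := by
  have hmem : s ∈ nhdsWithin m (Iio m) := nhdsWithin_le_nhds (hs.mem_nhds hm)
  obtain ⟨x, hx, hlt⟩ := Filter.nonempty_of_mem (Filter.inter_mem hmem self_mem_nhdsWithin)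
  have hslope := hconv.slope_le_deriv hx hm hlt hc
  rw [slope_def_field] at hslope
  exact (div_pos (sub_pos.2 (hmono hx hm hlt)) (sub_pos.2 hlt)).trans_le hslope

theorem isMaxOn_sub_iff_deriv_eq (hs : IsOpen s) (hm : m ∈ s) (hconv : ConvexOn ℝ s c)
    (hc : DifferentiableAt ℝ c m) (hf : DifferentiableAt ℝ f m)
    (htangent : ∀ x ∈ s, f x ≤ f m + f' * (x - m)) :
    IsMaxOn (fun x => f x - c x) s m ↔ deriv c m = f' := by
  have hnhds := hs.mem_nhds hm
  constructor
  · intro hmax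
    have hslope : deriv f m = f' := by
      have hloc : IsLocalMax (fun x => f x - f' * (x - m)) m := by
        filter_upwards [hnhds] with x hx
        linarith [htangent x hx]
      have hderiv := hf.hasDerivAt.sub (((hasDerivAt_id m).sub_const m).const_mul f')
      linarith [hloc.hasDerivAt_eq_zero hderiv]
    have hcrit := (hmax.isLocalMax hnhds).hasDerivAt_eq_zero (hf.hasDerivAt.sub hc.hasDerivAt)
    linarith
  · rintro rfl x hx
    change f x - c x ≤ f m - c m
    linarith [htangent x hx, deriv_mul_sub_le_of_convexOn hconv hm hx hc]

theorem exists_deriv_eq_of_lt_of_lt (hab : a ≤ b)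
    (hc : ∀ x ∈ Icc a b, DifferentiableAt ℝ c x) (hg : ContinuousOn g (Icc a b))
    (ha : deriv c a < g a) (hb : g b < deriv c b) : ∃ m ∈ Ioo a b, deriv c m = g m := by
  have hext : Continuous (IccExtend hab (domRestrict (Icc a b) g)) :=
    (continuousOn_iff_continuous_domRestrict.1 hg).Icc_extend'
  have hderiv (x : ℝ) (hx : x ∈ Icc a b) : HasDerivWithinAt
      (fun x => c x - ∫ t in a..x, IccExtend hab (domRestrict (Icc a b) g) t)
      (deriv c x - g x) (Icc a b) x := by
    have hint := (hext.integral_hasStrictDerivAt a x).hasDerivAt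
    rw [IccExtend_of_mem hab _ hx] at hint
    exact ((hc x hx).hasDerivAt.sub hint).hasDerivWithinAt
  obtain ⟨m, hm, hzero⟩ := exists_hasDerivWithinAt_eq_of_gt_of_lt hab hderiv
    (sub_neg.2 ha) (sub_pos.2 hb)
  exact ⟨m, hm, sub_eq_zero.1 hzero⟩

end ConvexCost

section Equilibrium

variable {lam r r' m m' : ℝ} {c : ℝ → ℝ}

theorem idleProb_update (hlam : 0 < lam) (hm : lam / 2 < m) (i : Fin 2) {x : ℝ}
    (hx : lam / 2 < x) :
    idleProb lam r (Function.update (fun _ => m) i x) i = 1 - busyProb lam x m ((m / x) ^ r) := by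
  have hμ (j : Fin 2) : lam / 2 < Function.update (fun _ => m) i x j := by
    by_cases hj : j = i <;> simp [hj, hx, hm]
  have hrev : Fin.rev i ≠ i := by fin_cases i <;> decide
  rw [idleProb_eq_one_sub_busyProb hlam (fun j => (half_pos hlam).trans (hμ j))
    (by linarith [hμ 0, hμ 1]), Function.update_self, Function.update_of_ne hrev]

theorem isSymmetricEquilibrium_iff_isMaxOn (hlam : 0 < lam) :
    IsSymmetricEquilibrium lam r c m ↔ lam / 2 < m ∧
      IsMaxOn (fun x => 1 - busyProb lam x m ((m / x) ^ r) - c x) (Ioi (lam / 2)) m := by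
  rw [IsSymmetricEquilibrium, IsNashEquilibrium, forall_const]
  refine and_congr_right fun hm => ?_
  have hutility (i : Fin 2) (x : ℝ) (hx : lam / 2 < x) :
      utility lam r c (Function.update (fun _ => m) i x) i =
        1 - busyProb lam x m ((m / x) ^ r) - c x := by
    rw [utility, idleProb_update hlam hm i hx, Function.update_self]
  have hdiag (i : Fin 2) : utility lam r c (fun _ => m) i =
      1 - busyProb lam m m ((m / m) ^ r) - c m := by
    simpa only [Function.update_eq_self] using hutility i m hm
  refine ⟨fun h x hx => ?_, fun h i x hx => ?_⟩
  · have hle := h 0 x hx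
    rwa [hutility 0 x hx, hdiag 0] at hle
  · rw [hutility i x hx, hdiag i]
    exact h hx

theorem isSymmetricEquilibrium_iff (hlam : 0 < lam) (hconv : ConvexOn ℝ (Ioi 0) c)
    (hdiff : ∀ x > 0, DifferentiableAt ℝ c x) (hr : r ∈ Icc (-2) 1) :
    IsSymmetricEquilibrium lam r c m ↔ lam / 2 < m ∧ deriv c m = marginalIdle lam r m := by
  rw [isSymmetricEquilibrium_iff_isMaxOn hlam]
  refine and_congr_right fun hm => ?_
  have hm0 : 0 < m := (half_pos hlam).trans hm
  refine isMaxOn_sub_iff_deriv_eq isOpen_Ioi hm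
    (hconv.subset (Ioi_subset_Ioi (half_pos hlam).le) (convex_Ioi _)) (hdiff m hm0)
    ((differentiableAt_busyProb hlam hm0).const_sub 1) fun x hx => ?_
  rw [div_self hm0.ne', Real.one_rpow, busyProb_one hlam hm0]
  linarith [tangent_le_busyProb_rpow hlam hx hm hr]

theorem strictAntiOn_marginalIdle_sub_deriv (hlam : 0 < lam) (hconv : ConvexOn ℝ (Ioi 0) c)
    (hdiff : ∀ x > 0, DifferentiableAt ℝ c x) (hr : r ∈ Icc (-2) 1) :
    StrictAntiOn (fun m => marginalIdle lam r m - deriv c m) (Ioi 0) := by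
  simp only [sub_eq_add_neg]
  exact (strictAntiOn_marginalIdle hlam (by linarith [hr.1]) (by linarith [hr.2])).add_antitone
    (hconv.monotoneOn_deriv hdiff).neg

theorem exists_deriv_eq_marginalIdle (hlam : 0 < lam) (hmono : StrictMonoOn c (Ioi 0))
    (hconv : ConvexOn ℝ (Ioi 0) c) (hdiff : ∀ x > 0, DifferentiableAt ℝ c x)
    (hc' : deriv c (lam / 2) < 1 / lam) (hr : r ∈ Icc (-2) 1) :
    ∃ m > lam / 2, deriv c m = marginalIdle lam r m := by
  have hhalf : 0 < lam / 2 := half_pos hlam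
  have hpos : 0 < deriv c (lam / 2) :=
    deriv_pos_of_convexOn_of_strictMonoOn isOpen_Ioi hconv hmono hhalf (hdiff _ hhalf)
  set b := lam / 2 + 3 / deriv c (lam / 2) with hb
  have hab : lam / 2 < b := lt_add_of_pos_right _ (by positivity)
  have hb0 : 0 < b := hhalf.trans hab
  have hright : marginalIdle lam r b < deriv c b := by
    calc marginalIdle lam r b < 3 / b :=
          marginalIdle_lt hlam (by linarith [hr.1]) (by linarith [hr.2]) hb0
      _ ≤ deriv c (lam / 2) := by
          rw [div_le_iff₀ hb0, hb, mul_add, mul_div_cancel₀ _ hpos.ne']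
          exact le_add_of_nonneg_left (by positivity)
      _ ≤ deriv c b := hconv.monotoneOn_deriv hdiff hhalf hb0 hab.le
  obtain ⟨m, hm, heq⟩ := exists_deriv_eq_of_lt_of_lt hab.le
    (fun x hx => hdiff x (hhalf.trans_le hx.1))
    ((continuousOn_marginalIdle hlam).mono fun x hx => hhalf.trans_le hx.1)
    (by rwa [marginalIdle_half hlam]) hright
  exact ⟨m, hm.1, heq⟩

theorem existsUnique_isSymmetricEquilibrium (hlam : 0 < lam) (hmono : StrictMonoOn c (Ioi 0))
    (hconv : ConvexOn ℝ (Ioi 0) c) (hdiff : ∀ x > 0, DifferentiableAt ℝ c x)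
    (hc' : deriv c (lam / 2) < 1 / lam) (hr : r ∈ Icc (-2) 1) :
    ∃! m, IsSymmetricEquilibrium lam r c m := by
  simp only [isSymmetricEquilibrium_iff hlam hconv hdiff hr]
  refine existsUnique_of_exists_of_unique
    (exists_deriv_eq_marginalIdle hlam hmono hconv hdiff hc' hr) ?_
  rintro m m' ⟨hm, heq⟩ ⟨hm', heq'⟩
  refine (strictAntiOn_marginalIdle_sub_deriv hlam hconv hdiff hr).injOn
    ((half_pos hlam).trans hm) ((half_pos hlam).trans hm') ?_
  simp only [heq, heq', sub_self]

theorem IsSymmetricEquilibrium.lt_of_lt (hlam : 0 < lam) (hconv : ConvexOn ℝ (Ioi 0) c)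
    (hdiff : ∀ x > 0, DifferentiableAt ℝ c x) (hr : r ∈ Icc (-2) 1) (hr' : r' ∈ Icc (-2) 1)
    (hrr' : r < r') (h : IsSymmetricEquilibrium lam r c m)
    (h' : IsSymmetricEquilibrium lam r' c m') : m' < m := by
  obtain ⟨hm, heq⟩ := (isSymmetricEquilibrium_iff hlam hconv hdiff hr).1 h
  obtain ⟨hm', heq'⟩ := (isSymmetricEquilibrium_iff hlam hconv hdiff hr').1 h'
  refine ((strictAntiOn_marginalIdle_sub_deriv hlam hconv hdiff hr).lt_iff_gt
    ((half_pos hlam).trans hm) ((half_pos hlam).trans hm')).1 ?_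
  simp only [heq, heq', sub_self, sub_pos]
  exact marginalIdle_lt_marginalIdle hlam hm' hrr'

end Equilibrium

section ResponseTime

variable {lam r m : ℝ}

theorem routingProb_const (hm : 0 < m) (i : Fin 2) :
    routingProb r (fun _ => m) Finset.univ i = 1 / 2 := by
  rw [routingProb_univ_eq (fun _ => hm), div_self hm.ne', Real.one_rpow, one_add_one_eq_two]

theorem steadyState_const (hlam : 0 < lam) (hm : lam / 2 < m) :
    steadyState lam r (fun _ => m) = fun
      | .empty => (2 * m - lam) / (2 * m + lam)
      | .single _ => lam * (2 * m - lam) / (2 * m * (2 * m + lam))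
      | .busy k => (lam / (2 * m)) ^ k *
          (lam ^ 2 * (2 * m - lam) / (2 * m ^ 2 * (2 * m + lam))) := by
  have hm0 : 0 < m := (half_pos hlam).trans hm
  have hsub : 2 * m - lam ≠ 0 := by linarith
  have hmass : totalWeight lam (routingProb r (fun _ => m) Finset.univ) (fun _ => m) =
      2 * m ^ 2 * (m + lam) * (2 * m + lam) / (2 * m - lam) := by
    simp only [totalWeight, routingProb_const hm0, ← two_mul]
    rw [eq_div_iff hsub, add_mul, div_mul_cancel₀ _ hsub]
    ring
  rw [steadyState_eq hlam (fun _ => hm0) (by linarith), hmass]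
  funext s
  cases s <;> simp only [Pi.smul_apply, smul_eq_mul, weight, routingProb_const hm0, ← two_mul] <;>
    field_simp <;> ring

theorem meanResponseFrom_const (hm : 0 < m) :
    meanResponseFrom r (fun _ => m) = fun
      | .empty => 1 / m
      | .single _ => 1 / m
      | .busy k => (k + 3) / (2 * m) := by
  funext s
  cases s <;> simp only [meanResponseFrom, routingProb_const hm, Fin.sum_univ_two] <;>
    field_simp <;> ring

theorem hasMeanResponseTime_const (hlam : 0 < lam) (hm : lam / 2 < m) :
    HasMeanResponseTime lam r (fun _ => m) (4 * m / (4 * m ^ 2 - lam ^ 2)) := by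
  have hm0 : 0 < m := (half_pos hlam).trans hm
  have hnorm : ‖lam / (2 * m)‖ < 1 := by
    rw [Real.norm_of_nonneg (by positivity), div_lt_one (by positivity)]
    linarith
  have hone : 1 - lam / (2 * m) = (2 * m - lam) / (2 * m) := one_sub_div (by positivity)
  have hgeometric := (hasSum_coe_mul_geometric_of_norm_lt_one hnorm).add
    ((hasSum_geometric_of_norm_lt_one hnorm).mul_left 3)
  have hfactor : 4 * m ^ 2 - lam ^ 2 = (2 * m - lam) * (2 * m + lam) := by ring
  have hsum : HasSum (fun s => steadyState lam r (fun _ => m) s * meanResponseFrom r (fun _ => m) s)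
      _ := hasSum_state <| (hgeometric.mul_left
        (lam ^ 2 * (2 * m - lam) / (2 * m ^ 2 * (2 * m + lam)) / (2 * m))).congr_fun fun k => by
          simp only [steadyState_const hlam hm, meanResponseFrom_const hm0]
          ring
  rw [HasMeanResponseTime]
  convert hsum using 1
  simp only [steadyState_const hlam hm, meanResponseFrom_const hm0]
  rw [hone, hfactor]
  field_simp
  ring

theorem strictAntiOn_meanResponseTime (hlam : 0 < lam) :
    StrictAntiOn (fun m => 4 * m / (4 * m ^ 2 - lam ^ 2)) (Ioi (lam / 2)) := by
  intro a ha b hb hab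
  have ha0 : 0 < a := (half_pos hlam).trans ha
  have hb0 : 0 < b := (half_pos hlam).trans hb
  have hden (x : ℝ) (hx : lam / 2 < x) : 0 < 4 * x ^ 2 - lam ^ 2 := by
    have hfactor : 0 < (2 * x - lam) * (2 * x + lam) := mul_pos (by linarith) (by linarith)
    linarith
  have hcross : 0 < (b - a) * (16 * a * b + 4 * lam ^ 2) :=
    mul_pos (sub_pos.2 hab) (by positivity)
  change 4 * b / (4 * b ^ 2 - lam ^ 2) < 4 * a / (4 * a ^ 2 - lam ^ 2)
  rw [div_lt_div_iff₀ (hden b hb) (hden a ha)]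
  linarith

end ResponseTime

end MM2

theorem theorem13_general (lam : ℝ) (hlam : 0 < lam) (c : ℝ → ℝ) (hmono : StrictMonoOn c (Ioi 0))
    (hconv : ConvexOn ℝ (Ioi 0) c) (hdiff : ∀ x > 0, DifferentiableAt ℝ c x)
    (hc' : deriv c (lam / 2) < 1 / lam) :
    (∀ (r : ℝ) (μ : Fin 2 → ℝ), (∀ i, 0 < μ i) → lam < μ 0 + μ 1 →
      ∃! π, MM2.IsSteadyState lam r μ π) ∧
    (∀ r ∈ Icc (-2 : ℝ) 1, ∃! m, MM2.IsSymmetricEquilibrium lam r c m) ∧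
    (∀ r ∈ Icc (-2 : ℝ) 1, ∀ r' ∈ Icc (-2 : ℝ) 1, r < r' → ∀ m m' : ℝ,
      MM2.IsSymmetricEquilibrium lam r c m → MM2.IsSymmetricEquilibrium lam r' c m' →
      ∃ T T' : ℝ, MM2.HasMeanResponseTime lam r (fun _ => m) T ∧
        MM2.HasMeanResponseTime lam r' (fun _ => m') T' ∧ T < T') := by
  refine ⟨fun r μ hμ hs => MM2.existsUnique_isSteadyState hlam hμ hs,
    fun r hr => MM2.existsUnique_isSymmetricEquilibrium hlam hmono hconv hdiff hc' hr,
    fun r hr r' hr' hrr' m m' h h' => ?_⟩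
  have hm : lam / 2 < m := h.1 0
  have hm' : lam / 2 < m' := h'.1 0
  exact ⟨_, _, MM2.hasMeanResponseTime_const hlam hm, MM2.hasMeanResponseTime_const hlam hm',
    MM2.strictAntiOn_meanResponseTime hlam hm' hm (h.lt_of_lt hlam hconv hdiff hr hr' hrr' h')⟩

/-- The first part says that the steady state, and so the game, is well defined on the whole
action space; the second is existence and uniqueness of the symmetric equilibrium; the third
compares the mean response times at the symmetric equilibria for `r = -2` and `r = 0`. -/
theorem theorem13 (lam : ℝ) (hlam : 0 < lam) (c : ℝ → ℝ) (hc : MM2.IsEffortCost c)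
    (hc' : deriv c (lam / 2) < 1 / lam) :
    (∀ (r : ℝ) (μ : Fin 2 → ℝ), (∀ i, lam / 2 < μ i) → ∃! π, MM2.IsSteadyState lam r μ π) ∧
    (∀ r ∈ ({-2, -1, 0, 1} : Set ℝ), ∃! m, MM2.IsSymmetricEquilibrium lam r c m) ∧
    (∀ m₂ m₀ : ℝ, MM2.IsSymmetricEquilibrium lam (-2) c m₂ →
      MM2.IsSymmetricEquilibrium lam 0 c m₀ →
      ∃ T₂ T₀ : ℝ, MM2.HasMeanResponseTime lam (-2) (fun _ => m₂) T₂ ∧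
        MM2.HasMeanResponseTime lam 0 (fun _ => m₀) T₀ ∧ T₂ < T₀) := by
  obtain ⟨hsteady, hunique, hcompare⟩ := theorem13_general lam hlam c hc.strictMonoOn hc.convexOn
    (by simpa using hc.differentiableAt 0 (by norm_num)) hc'
  refine ⟨fun r μ hμ => hsteady r μ (fun i => (half_pos hlam).trans (hμ i))
    (by linarith [hμ 0, hμ 1]), fun r hr => hunique r ?_,
    hcompare (-2) (by norm_num) 0 (by norm_num) (by norm_num)⟩
  rcases hr with rfl | rfl | rfl | rfl <;> norm_num
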